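/- All channels are binary-input discrete memoryless channels $W$ with input alphabet $\{0,1\}$ (uniform input) and a discrete output alphabet. Write $W\preccurlyeq W'$ ($W$ is a degradation of $W'$) if $\Pr_W(y\mid a)=\sum_{y'}\Pr_{W'}(y'\mid a)K(y\mid y')$ for some channel $K$, and $W\cong W'$ if the two channels have the same likelihood-ratio profile, i.e. for every $\varepsilon\in[0,1]$ the probabilities that the output $y$ satisfies $\Pr(y\mid 0)/\Pr(y\mid 1)=\varepsilon/(1-\varepsilon)$ coincide. Let $P_\epsilon(W)=\frac12\sum_y\min\{\Pr(y\mid0),\Pr(y\mid1)\}$. Let $\sum_j p_j\mathrm B(\varepsilon_j)$ denote the channel that uses the binary symmetric channel $\mathrm B(\varepsilon_j)$ of crossover probability $\varepsilon_j$ with probability $p_j$ and reveals $j$ at the output; $\mathbb B_n$ is the set of channels equivalent to such a channel with $n$ terms. A $2n$-P-degradation of $Q$ is a $W\in\mathbb B_n$ with $W\preccurlyeq Q$ and $P_\epsilon(W)=\min\{P_\epsilon(V): V\in\mathbb B_n,\ V\preccurlyeq Q\}$. Let $2\le n<m$ and $Q\cong\sum_{i=1}^m q_i\mathrm B(\sigma_i)$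 with all $q_i>0$, $\sum_i q_i=1$ and $0\le\sigma_1<\dots<\sigma_m\le\frac12$; put $q_0=q_{m+1}=0$. For $1\le i_2<\dots<i_n\le m$ and $0\le s_j\le q_{i_j}$ $(2\le j\le n)$, put $i_1=s_1=0$, $i_{n+1}=m+1$, $s_{n+1}=0$, and let $D_Q(i_2,\dots,i_n;s_2,\dots,s_n)=\sum_{j=1}^n p_j\mathrm B(\varepsilon_j)$, where $$p_j=s_j+\sum_{i_j<i<i_{j+1}}q_i+(q_{i_{j+1}}-s_{j+1}),\qquad p_j\varepsilon_j=s_j\sigma_{i_j}+\sum_{i_j<i<i_{j+1}}q_i\sigma_i+(q_{i_{j+1}}-s_{j+1})\sigma_{i_{j+1}}$$ (terms with index $0$ or $m+1$ being $0$). The pairs $(i_2,s_2),\dots,(i_n,s_n)$ are its splitting patterns. A channel $W\cong D_Q(i_2,\dots,i_n;s_2,\dots,s_n)$ is called a $2n$-P$^*$-degradation of $Q$ with these splitting patterns if it is a $2n$-P-degradation of $Q$, all $p_j>0$, $0\le\varepsilon_1<\dots<\varepsilon_n\le\frac12$, and for every $j\in\{1,\dots,n\}$ with $i_{j+1}=i_j+1$: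 1. if $s_j=0$, then $s_{j+1}=0$ and $p_j\mathrm B(\varepsilon_j)=q_{i_{j+1}}\mathrm B(\sigma_{i_{j+1}})$ (same weight and crossover probability); 2. if $s_{j+1}=q_{i_{j+1}}$, then $s_j=q_{i_j}$ and $p_j\mathrm B(\varepsilon_j)=q_{i_j}\mathrm B(\sigma_{i_j})$. **Theorem.** Let $W$ and $W'$ be $2n$-P$^*$-degradations of $Q$ such that at most two of the splitting patterns of $W$ are not splitting patterns of $W'$ (in particular, this holds if the two sequences of splitting patterns differ in at most two positions). If $W\preccurlyeq W'$, then $W\cong W'$. That is, one cannot obtain a $2n$-P$^*$-degradation $W'\not\cong W$ of $Q$ with $W\preccurlyeq W'$ by adjusting at most two splitting patterns of $W$. -/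

import Mathlib

noncomputable section

/-- A binary-input discrete memoryless channel with output alphabet `Y`:
`W a y = Pr(y | x = a)` for the inputs `a ∈ {0, 1}`. The input is uniformly distributed. -/
abbrev BIDMC (Y : Type*) := ZMod 2 → PMF Y

/-- The LR-profile `P_W(ε) = Pr(y ∈ L_W(ε))`, where `L_W(ε)` is the set of outputs with
`Pr(y | 0) / Pr(y | 1) = ε / (1 - ε)`. The equation between ratios is multiplied out, so that
`ε = 1` (infinite likelihood ratio) is covered; outputs that never occur contribute `0`. -/
def BIDMC.lrProfile {Y : Type*} (W : BIDMC Y) (ε : ℝ) : ENNReal :=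
  open scoped Classical in
  ∑' y, if (W 0 y).toReal * (1 - ε) = (W 1 y).toReal * ε then (W 0 y + W 1 y) / 2 else 0

/-- Equivalence `W ≅ W'` of channels: the LR-profiles coincide. -/
def BIDMC.Equivalent {Y Y' : Type*} (W : BIDMC Y) (W' : BIDMC Y') : Prop :=
  ∀ ε ∈ Set.Icc (0 : ℝ) 1, W.lrProfile ε = W'.lrProfile ε

/-- `W.IsDegradationOf W'` means `W ≼ W'`: `W` arises from `W'` by an intermediate channel `K`,
`Pr(y | a) = ∑ y', Pr(y' | a) * K(y | y')`. -/
def BIDMC.IsDegradationOf {Y Y' : Type*} (W : BIDMC Y) (W' : BIDMC Y') : Prop :=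
  ∃ K : Y' → PMF Y, ∀ a, W a = (W' a).bind K

/-- The error probability of maximum likelihood decoding. -/
def BIDMC.errorProb {Y : Type*} (W : BIDMC Y) : ENNReal :=
  (∑' y, min (W 0 y) (W 1 y)) / 2

/-- A formal expression `∑ j, p_j B(ε_j)`: weights `p_j ≥ 0` of sum `1` and crossover
probabilities `ε_j ∈ [0, 1]` of `n` binary symmetric channels. -/
structure BSCMix (n : ℕ) where
  weight : Fin n → ℝ
  cross : Fin n → ℝ
  weight_nonneg : ∀ j, 0 ≤ weight j
  weight_sum : ∑ j, weight j = 1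
  cross_nonneg : ∀ j, 0 ≤ cross j
  cross_le_one : ∀ j, cross j ≤ 1

/-- The random switching channel `∑ j, p_j B(ε_j)`. The output `(j, b)` consists of the index `j`
of the binary symmetric channel that was used and of its output bit `b`. -/
def BSCMix.channel {n : ℕ} (M : BSCMix n) : BIDMC (Fin n × ZMod 2) := fun a =>
  PMF.ofFintype
    (fun y => ENNReal.ofReal (M.weight y.1 * if y.2 = a then 1 - M.cross y.1 else M.cross y.1)) <| by
    have hnn : ∀ y : Fin n × ZMod 2,
        0 ≤ M.weight y.1 * if y.2 = a then 1 - M.cross y.1 else M.cross y.1 := by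
      intro y
      refine mul_nonneg (M.weight_nonneg _) ?_
      split_ifs
      · linarith [M.cross_le_one y.1]
      · exact M.cross_nonneg _
    rw [← ENNReal.ofReal_sum_of_nonneg fun y _ => hnn y, Fintype.sum_prod_type]
    have hin : ∀ j, ∑ b : ZMod 2,
        (M.weight j * if b = a then 1 - M.cross j else M.cross j) = M.weight j := by
      intro j
      rw [← Finset.mul_sum, ← Finset.add_sum_erase _ _ (Finset.mem_univ a), if_pos rfl,
        Finset.sum_congr rfl fun b hb => if_neg (Finset.ne_of_mem_erase hb), Finset.sum_const,
        Finset.card_erase_of_mem (Finset.mem_univ a), Finset.card_univ, ZMod.card]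
      simp
    simp only [hin, M.weight_sum, ENNReal.ofReal_one]

/-- All weights are positive and `0 ≤ ε_1 < ⋯ < ε_n ≤ 1/2`. -/
def BSCMix.IsReduced {n : ℕ} (M : BSCMix n) : Prop :=
  (∀ j, 0 < M.weight j) ∧ StrictMono M.cross ∧ ∀ j, M.cross j ≤ 1 / 2

/-- `W ∈ 𝔹_n`: `W` is equivalent to a random switching channel of `n` binary symmetric
channels. -/
def BIDMC.MemB {Y : Type*} (W : BIDMC Y) (n : ℕ) : Prop :=
  ∃ M : BSCMix n, W.Equivalent M.channel

/-- `W` is a `2n`-P-degradation of `Q`: a degradation in `𝔹_n` of the least error probability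
among the degradations in `𝔹_n`. -/
def BIDMC.IsPDegradationOf {Y A : Type*} (W : BIDMC Y) (n : ℕ) (Q : BIDMC A) : Prop :=
  W.MemB n ∧ W.IsDegradationOf Q ∧
    ∀ (Y' : Type) (W' : BIDMC Y'), W'.MemB n → W'.IsDegradationOf Q → W.errorProb ≤ W'.errorProb

/-- The numbers `a_1, …, a_m` as a function of an index `k ≥ 0`, with value `0` for `k = 0` and
for `k > m` (the convention `q_0 = q_{m+1} = 0`). -/
def padded {m : ℕ} (a : Fin m → ℝ) (k : ℕ) : ℝ :=
  if h : 1 ≤ k ∧ k ≤ m then a ⟨k - 1, by omega⟩ else 0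

/-- The sequences `0 = i_1 < i_2 < ⋯ < i_n < i_{n+1} = m + 1` and `s_1 = 0, s_2, …, s_n,
s_{n+1} = 0` with `0 ≤ s_j ≤ q_{i_j}`. The value of `i_j`, `s_j` is `idx`, `amt` at `j - 1`. -/
structure Splitting {m : ℕ} (M : BSCMix m) (n : ℕ) where
  idx : Fin (n + 1) → ℕ
  amt : Fin (n + 1) → ℝ
  idx_first : idx 0 = 0
  idx_last : idx (Fin.last n) = m + 1
  idx_strictMono : StrictMono idx
  amt_first : amt 0 = 0
  amt_last : amt (Fin.last n) = 0
  amt_nonneg : ∀ j, 0 ≤ amt j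
  amt_le : ∀ j, amt j ≤ padded M.weight (idx j)

namespace Splitting

variable {m n : ℕ} {M : BSCMix m}

/-- The splitting patterns `(i_2, s_2), …, (i_n, s_n)`. -/
def patterns (P : Splitting M n) : Set (ℕ × ℝ) :=
  {x | ∃ j, j ≠ 0 ∧ j ≠ Fin.last n ∧ x = (P.idx j, P.amt j)}

/-- The weight of `B(σ_k)` in the `j`-th segment, that is, in the
`(i_j, i_{j+1}; s_j, s_{j+1})`-segment. -/
def segWeight (P : Splitting M n) (j : Fin n) (k : ℕ) : ℝ :=
  if k = P.idx j.castSucc then P.amt j.castSucc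
  else if k = P.idx j.succ then padded M.weight k - P.amt j.succ
  else if P.idx j.castSucc < k ∧ k < P.idx j.succ then padded M.weight k
  else 0

/-- `D = ∑ j, p_j B(ε_j)` is the expression in which each `p_j B(ε_j)` is compounded from the
`j`-th segment. -/
def Compounds (P : Splitting M n) (D : BSCMix n) : Prop :=
  ∀ j, D.weight j = ∑ k ∈ Finset.range (m + 2), P.segWeight j k ∧
    D.weight j * D.cross j = ∑ k ∈ Finset.range (m + 2), P.segWeight j k * padded M.cross k

/-- The conditions on adjacent splitting indices: if `i_{j+1} = i_j + 1` for some `j ∈ [n]`, then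
`s_{j+1} = 0` and `p_j B(ε_j) = q_{i_{j+1}} B(σ_{i_{j+1}})` when `s_j = 0`, and
`s_j = q_{i_j}` and `p_j B(ε_j) = q_{i_j} B(σ_{i_j})` when `s_{j+1} = q_{i_{j+1}}`. -/
def AdjacencyConditions (P : Splitting M n) (D : BSCMix n) : Prop :=
  ∀ j : Fin n, P.idx j.succ = P.idx j.castSucc + 1 →
    (P.amt j.castSucc = 0 →
      P.amt j.succ = 0 ∧ D.weight j = padded M.weight (P.idx j.succ) ∧
        D.cross j = padded M.cross (P.idx j.succ)) ∧
    (P.amt j.succ = padded M.weight (P.idx j.succ) →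
      P.amt j.castSucc = padded M.weight (P.idx j.castSucc) ∧
        D.weight j = padded M.weight (P.idx j.castSucc) ∧
        D.cross j = padded M.cross (P.idx j.castSucc))

end Splitting

/-- `W` is the `2n`-P*-degradation `D_Q(i_2, …, i_n; s_2, …, s_n)` of `Q ≅ M.channel`, given by
the splitting patterns `P`. -/
def BIDMC.IsPStarDegradation {m n : ℕ} {A Y : Type*} (W : BIDMC Y) (Q : BIDMC A)
    {M : BSCMix m} (P : Splitting M n) : Prop :=
  W.IsPDegradationOf n Q ∧
    ∃ D : BSCMix n, D.IsReduced ∧ P.Compounds D ∧ P.AdjacencyConditions D ∧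
      W.Equivalent D.channel

end

/-! The Lorenz curve of `Q` plots cumulative weight against cumulative weight times crossover
probability, the binary symmetric channels being taken in increasing order of `σ_i`. It is convex
and has slope `σ_i` along the `i`-th atom, of length `q_i`. The splitting patterns are points of
this curve, and the Lorenz curve of `D_Q` is the inscribed polygon with these vertices: `pos` is the
abscissa and `cut (padded M.cross)` the ordinate.

If `W ≼ W'`, Jensen's inequality for `min ε t` puts the polygon of `W` above that of `W'`
(`truncatedError_le`, `cut_sub_le_cut_sub`). The polygon of `W'` also lies above the curve of `Q`,
so it touches this curve at each vertex of `W`. When such a vertex is interior to a segment of `W'`,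
convexity puts the segment on the line of one atom, and the adjacency conditions make it the whole
atom (`segment_eq_atom`). The adjacency conditions of `W` then push the neighbouring vertices of `W`
strictly beyond that atom. Two inductions, one from each end, show that the vertices coincide
(`pos_eq_of_sum_min_le`). -/

/-! ### Truncated errors: monotonicity under degradation and invariance under equivalence. -/

namespace BIDMC

variable {Y Y' : Type*}

/-- The concave functional `∑ y, min (Pr(y | 0)) (Pr(y | 1)) (t * (Pr(y | 0) + Pr(y | 1)))`. -/
noncomputable def truncatedError (W : BIDMC Y) (t : ENNReal) : ENNReal :=
  ∑' y, min (min (W 0 y) (W 1 y)) (t * (W 0 y + W 1 y))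

/-- The function `min a b (t * (a + b))` is positively homogeneous and superadditive, so merging
outputs through `K` can only increase the sum. -/
theorem IsDegradationOf.truncatedError_le {W : BIDMC Y} {W' : BIDMC Y'}
    (h : W.IsDegradationOf W') (t : ENNReal) : W'.truncatedError t ≤ W.truncatedError t := by
  obtain ⟨K, hK⟩ := h
  have hW : ∀ a y, W a y = ∑' y', W' a y' * K y' y := fun a y => by
    rw [hK a, PMF.bind_apply]
  calc W'.truncatedError t
      = ∑' y', ∑' y, min (min (W' 0 y') (W' 1 y')) (t * (W' 0 y' + W' 1 y')) * K y' y := by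
        refine tsum_congr fun y' => ?_
        rw [ENNReal.tsum_mul_left, PMF.tsum_coe, mul_one]
    _ = ∑' y, ∑' y', min (min (W' 0 y') (W' 1 y')) (t * (W' 0 y' + W' 1 y')) * K y' y :=
        ENNReal.tsum_comm
    _ ≤ W.truncatedError t := by
        refine ENNReal.tsum_le_tsum fun y => le_min (le_min ?_ ?_) ?_
        · rw [hW]
          exact ENNReal.tsum_le_tsum fun y' =>
            mul_le_mul_left ((min_le_left _ _).trans (min_le_left _ _)) _
        · rw [hW]
          exact ENNReal.tsum_le_tsum fun y' =>
            mul_le_mul_left ((min_le_left _ _).trans (min_le_right _ _)) _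
        · rw [hW, hW, ← ENNReal.tsum_add, ← ENNReal.tsum_mul_left]
          refine ENNReal.tsum_le_tsum fun y' => ?_
          rw [← add_mul, ← mul_assoc]
          exact mul_le_mul_left (min_le_right _ _) _

/-- The contribution of an output to the truncated error depends only on its probability and
its likelihood ratio. -/
theorem tsum_lrCell_eq (a b t : ENNReal) (ha : a ≠ ⊤) (hb : b ≠ ⊤) :
    (∑' ε : Set.Icc (0 : ℝ) 1, open scoped Classical in
      (if a.toReal * (1 - (ε : ℝ)) = b.toReal * ε then (a + b) / 2 else 0) *
        (2 * min (min (ENNReal.ofReal ε) (ENNReal.ofReal (1 - ε))) t)) =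
      min (min a b) (t * (a + b)) := by
  classical
  by_cases h0 : a + b = 0
  · obtain ⟨rfl, rfl⟩ := add_eq_zero.mp h0
    simp
  have htop : a + b ≠ ⊤ := ENNReal.add_ne_top.mpr ⟨ha, hb⟩
  have hsum : (a + b).toReal = a.toReal + b.toReal := ENNReal.toReal_add ha hb
  have hpos : 0 < a.toReal + b.toReal := hsum ▸ ENNReal.toReal_pos h0 htop
  have hε : a.toReal / (a.toReal + b.toReal) ∈ Set.Icc (0 : ℝ) 1 :=
    ⟨by positivity, (div_le_one hpos).mpr (by linarith [b.toReal_nonneg])⟩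
  have hmulA : (a + b) * ENNReal.ofReal (a.toReal / (a.toReal + b.toReal)) = a := by
    rw [← ENNReal.ofReal_toReal htop, ← ENNReal.ofReal_mul ENNReal.toReal_nonneg, hsum,
      mul_div_cancel₀ _ hpos.ne', ENNReal.ofReal_toReal ha]
  have hmulB : (a + b) * ENNReal.ofReal (1 - a.toReal / (a.toReal + b.toReal)) = b := by
    have : (a.toReal + b.toReal) * (1 - a.toReal / (a.toReal + b.toReal)) = b.toReal := by
      field_simp
      ring
    rw [← ENNReal.ofReal_toReal htop, ← ENNReal.ofReal_mul ENNReal.toReal_nonneg, hsum,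
      this, ENNReal.ofReal_toReal hb]
  -- Only `ε = a / (a + b)` satisfies the ratio equation. The factor `2` cancels the half coming
  -- from the uniform input.
  rw [tsum_eq_single (⟨_, hε⟩ : Set.Icc (0 : ℝ) 1)]
  · rw [if_pos (by field_simp; ring), ← mul_assoc,
      ENNReal.div_mul_cancel (by norm_num) (by norm_num), mul_min, mul_min, hmulA, hmulB,
      mul_comm t]
  · intro ε hne
    rw [if_neg, zero_mul]
    intro h
    refine hne (Subtype.ext ?_)
    change (ε : ℝ) = a.toReal / (a.toReal + b.toReal)
    rw [eq_div_iff hpos.ne']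
    linarith

theorem truncatedError_eq_tsum_lrProfile (W : BIDMC Y) (t : ENNReal) :
    W.truncatedError t = ∑' ε : Set.Icc (0 : ℝ) 1,
      W.lrProfile ε * (2 * min (min (ENNReal.ofReal ε) (ENNReal.ofReal (1 - ε))) t) := by
  simp only [lrProfile, ← ENNReal.tsum_mul_right]
  rw [ENNReal.tsum_comm]
  exact tsum_congr fun y => (tsum_lrCell_eq _ _ t ((W 0).apply_ne_top y)
    ((W 1).apply_ne_top y)).symm

theorem Equivalent.truncatedError_eq {W : BIDMC Y} {W' : BIDMC Y'} (h : W.Equivalent W')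
    (t : ENNReal) : W.truncatedError t = W'.truncatedError t := by
  rw [truncatedError_eq_tsum_lrProfile, truncatedError_eq_tsum_lrProfile]
  exact tsum_congr fun ε => by rw [h ε ε.2]

end BIDMC

namespace BSCMix

variable {n : ℕ}

/-- Each of the two outputs of the `j`-th binary symmetric channel has likelihoods `p_j ε_j` and
`p_j (1 - ε_j)` in some order, whose sum is `p_j`; hence the factor `2`. -/
theorem truncatedError_channel (D : BSCMix n) (hD : ∀ j, D.cross j ≤ 1 / 2) {t : ℝ}
    (ht : 0 ≤ t) :
    D.channel.truncatedError (ENNReal.ofReal t) =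
      ENNReal.ofReal (2 * ∑ j, D.weight j * min (D.cross j) t) := by
  have key : ∀ (j : Fin n) (b : ZMod 2),
      min (min (D.channel 0 (j, b)) (D.channel 1 (j, b)))
        (ENNReal.ofReal t * (D.channel 0 (j, b) + D.channel 1 (j, b))) =
      ENNReal.ofReal (D.weight j * min (D.cross j) t) := by
    intro j b
    have hw := D.weight_nonneg j
    have hc := D.cross_nonneg j
    have hc' := hD j
    have h0 : 0 ≤ D.weight j * D.cross j := mul_nonneg hw hc
    have h1 : 0 ≤ D.weight j * (1 - D.cross j) := mul_nonneg hw (by linarith)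
    have hle : D.weight j * D.cross j ≤ D.weight j * (1 - D.cross j) :=
      mul_le_mul_of_nonneg_left (by linarith) hw
    have hs : ENNReal.ofReal t * (ENNReal.ofReal (D.weight j * D.cross j) +
        ENNReal.ofReal (D.weight j * (1 - D.cross j))) = ENNReal.ofReal (D.weight j * t) := by
      rw [← ENNReal.ofReal_add h0 h1, ← ENNReal.ofReal_mul ht]
      congr 1
      ring
    have hm : min (ENNReal.ofReal (D.weight j * D.cross j)) (ENNReal.ofReal (D.weight j * t)) =
        ENNReal.ofReal (D.weight j * min (D.cross j) t) := by
      rw [mul_min_of_nonneg _ _ hw, ENNReal.ofReal_min]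
    have hb : b = 0 ∨ b = 1 := by
      revert b
      decide
    rcases hb with rfl | rfl
    · simp only [channel, PMF.ofFintype_apply, if_true, zero_ne_one, if_false]
      rw [min_eq_right (ENNReal.ofReal_le_ofReal hle), add_comm, hs, hm]
    · simp only [channel, PMF.ofFintype_apply, if_true, one_ne_zero, if_false]
      rw [min_eq_left (ENNReal.ofReal_le_ofReal hle), hs, hm]
  rw [BIDMC.truncatedError, tsum_fintype, Fintype.sum_prod_type]
  simp only [key, Finset.sum_const, Finset.card_univ, ZMod.card]
  rw [← Finset.smul_sum, ← ENNReal.ofReal_sum_of_nonneg fun j _ =>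
    mul_nonneg (D.weight_nonneg j) (le_min (D.cross_nonneg j) ht), nsmul_eq_mul,
    ENNReal.ofReal_mul zero_le_two]
  simp

end BSCMix

/-! ### The Lorenz curve of `Q` and its supporting lines. -/

theorem padded_of_mem {m : ℕ} (a : Fin m → ℝ) {k : ℕ} (h : 1 ≤ k ∧ k ≤ m) :
    padded a k = a ⟨k - 1, by omega⟩ := dif_pos h

theorem padded_of_not_mem {m : ℕ} (a : Fin m → ℝ) {k : ℕ} (h : ¬(1 ≤ k ∧ k ≤ m)) :
    padded a k = 0 := dif_neg h

theorem padded_nonneg {m : ℕ} {a : Fin m → ℝ} (ha : ∀ i, 0 ≤ a i) (k : ℕ) : 0 ≤ padded a k := by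
  unfold padded
  split_ifs
  exacts [ha _, le_rfl]

theorem padded_lt_padded {m : ℕ} {a : Fin m → ℝ} (ha : StrictMono a) {k l : ℕ} (hk : 1 ≤ k)
    (hkl : k < l) (hl : l ≤ m) : padded a k < padded a l := by
  rw [padded_of_mem a ⟨hk, by omega⟩, padded_of_mem a ⟨by omega, hl⟩]
  exact ha (Fin.mk_lt_mk.mpr (by omega))

namespace BSCMix

variable {m : ℕ} (M : BSCMix m)

/-- The sum of `q_i f_i` over the part of the expression below the splitting pattern `(a, r)`. -/
def cutSum (f : ℕ → ℝ) (a : ℕ) (r : ℝ) : ℝ :=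
  ∑ i ∈ Finset.range (a + 1), padded M.weight i * f i - r * f a

theorem cutSum_eq (f : ℕ → ℝ) (a : ℕ) (r : ℝ) :
    M.cutSum f a r = ∑ i ∈ Finset.range a, padded M.weight i * f i +
      (padded M.weight a - r) * f a := by
  rw [cutSum, Finset.sum_range_succ]
  ring

theorem cutSum_sub_const (f : ℕ → ℝ) (c : ℝ) (a : ℕ) (r : ℝ) :
    M.cutSum (fun i => f i - c) a r = M.cutSum f a r - c * M.cutSum (fun _ => 1) a r := by
  simp only [cutSum, mul_sub, Finset.sum_sub_distrib, ← Finset.sum_mul, mul_one]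
  ring

variable {M}

theorem IsReduced.padded_weight_pos (hM : M.IsReduced) {k : ℕ} (h : 1 ≤ k ∧ k ≤ m) :
    0 < padded M.weight k := by
  rw [padded_of_mem _ h]
  exact hM.1 _

theorem sum_range_weight_mono {a b : ℕ} (h : a ≤ b) :
    ∑ i ∈ Finset.range a, padded M.weight i ≤ ∑ i ∈ Finset.range b, padded M.weight i :=
  Finset.sum_le_sum_of_subset_of_nonneg (Finset.range_mono h)
    fun i _ _ => padded_nonneg M.weight_nonneg i

theorem IsReduced.sum_range_weight_lt (hM : M.IsReduced) {a b : ℕ} (ha : 1 ≤ a) (h : a < b)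
    (hb : a ≤ m) :
    ∑ i ∈ Finset.range a, padded M.weight i < ∑ i ∈ Finset.range b, padded M.weight i :=
  Finset.sum_lt_sum_of_subset (Finset.range_mono h.le) (Finset.mem_range.mpr h)
    (by simp) (hM.padded_weight_pos ⟨ha, hb⟩) fun i _ _ => padded_nonneg M.weight_nonneg i

theorem cutSum_self {f : ℕ → ℝ} {i : ℕ} (hf : f i = 0) (s : ℝ) :
    M.cutSum f i s = ∑ l ∈ Finset.range i, padded M.weight l * f l := by
  rw [cutSum_eq, hf, mul_zero, add_zero]

/-- `σ_i` is a subgradient of the Lorenz curve on the `i`-th atom, and it is exact only there. -/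
theorem IsReduced.cutSum_cross_sub_le (hM : M.IsReduced) {i a : ℕ} (hi : 1 ≤ i ∧ i ≤ m)
    (ha : a ≤ m + 1) (s : ℝ) {r : ℝ} (hr : 0 ≤ r) (hra : r ≤ padded M.weight a) :
    M.cutSum (fun k => padded M.cross k - padded M.cross i) i s ≤
        M.cutSum (fun k => padded M.cross k - padded M.cross i) a r ∧
      (M.cutSum (fun k => padded M.cross k - padded M.cross i) a r ≤
        M.cutSum (fun k => padded M.cross k - padded M.cross i) i s →
        a = i ∨ (a + 1 = i ∧ r = 0) ∨ (a = i + 1 ∧ r = padded M.weight a)) := by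
  -- Subtracting `σ_i` tilts the curve so that it strictly decreases before the `i`-th atom, is
  -- constant along it and strictly increases after it. Its minimum points are thus those of the
  -- atom, whose ends may also be written with the index `i - 1` or `i + 1`.
  set f : ℕ → ℝ := fun k => padded M.cross k - padded M.cross i with hf
  have hfi : f i = 0 := sub_self _
  have hlt : ∀ k, 1 ≤ k → k < i → f k < 0 := fun k h1 h2 =>
    sub_neg.mpr (padded_lt_padded hM.2.1 h1 h2 hi.2)
  have hgt : ∀ k, i < k → k ≤ m → 0 < f k := fun k h1 h2 =>
    sub_pos.mpr (padded_lt_padded hM.2.1 hi.1 h1 h2)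
  have hlow : ∀ k, k < i → padded M.weight k * f k ≤ 0 := by
    intro k hk
    rcases Nat.eq_zero_or_pos k with rfl | h0
    · rw [padded_of_not_mem _ (by omega), zero_mul]
    · exact mul_nonpos_of_nonneg_of_nonpos (padded_nonneg M.weight_nonneg k) (hlt k h0 hk).le
  have hhigh : ∀ k, i ≤ k → 0 ≤ padded M.weight k * f k := by
    intro k hk
    rcases hk.eq_or_lt with rfl | hk
    · rw [hfi, mul_zero]
    by_cases hm : k ≤ m
    · exact mul_nonneg (padded_nonneg M.weight_nonneg k) (hgt k hk hm).le
    · rw [padded_of_not_mem _ (by omega), zero_mul]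
  rw [cutSum_self hfi]
  rcases lt_trichotomy a i with h | rfl | h
  · have hrf : r * f a ≤ 0 := by
      rcases Nat.eq_zero_or_pos a with rfl | h0
      · rw [padded_of_not_mem _ (by omega)] at hra
        rw [le_antisymm hra hr, zero_mul]
      · exact mul_nonpos_of_nonneg_of_nonpos hr (hlt a h0 h).le
    have hsplit : ∑ l ∈ Finset.range i, padded M.weight l * f l =
        ∑ l ∈ Finset.range (a + 1), padded M.weight l * f l +
          ∑ l ∈ Finset.Ico (a + 1) i, padded M.weight l * f l :=
      (Finset.sum_range_add_sum_Ico _ h).symm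
    have hIco : ∀ l ∈ Finset.Ico (a + 1) i, padded M.weight l * f l ≤ 0 := fun l hl =>
      hlow l (Finset.mem_Ico.mp hl).2
    have hnonpos := Finset.sum_nonpos hIco
    refine ⟨by rw [cutSum, hsplit]; linarith, fun hle => Or.inr (Or.inl ?_)⟩
    rw [cutSum, hsplit] at hle
    have hai : a + 1 = i := by
      by_contra hne
      have hmem : a + 1 ∈ Finset.Ico (a + 1) i := Finset.mem_Ico.mpr ⟨le_rfl, by omega⟩
      have hz := (Finset.sum_eq_zero_iff_of_nonpos hIco).mp (by linarith) _ hmem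
      exact (mul_neg_of_pos_of_neg (hM.padded_weight_pos ⟨by omega, by omega⟩)
        (hlt (a + 1) (by omega) (by omega))).ne hz
    refine ⟨hai, ?_⟩
    rcases Nat.eq_zero_or_pos a with rfl | h0
    · rw [padded_of_not_mem _ (by omega)] at hra
      exact le_antisymm hra hr
    · exact (mul_eq_zero.mp (le_antisymm hrf (by linarith))).resolve_right (hlt a h0 h).ne
  · exact ⟨(cutSum_self hfi r).ge, fun _ => Or.inl rfl⟩
  · have hrf : 0 ≤ (padded M.weight a - r) * f a := by
      by_cases hm : a ≤ m
      · exact mul_nonneg (sub_nonneg.mpr hra) (hgt a h hm).le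
      · rw [padded_of_not_mem _ (by omega)] at hra ⊢
        rw [le_antisymm hra hr, sub_zero, zero_mul]
    have hsplit : ∑ l ∈ Finset.range a, padded M.weight l * f l =
        ∑ l ∈ Finset.range i, padded M.weight l * f l +
          ∑ l ∈ Finset.Ico i a, padded M.weight l * f l :=
      (Finset.sum_range_add_sum_Ico _ h.le).symm
    have hIco : ∀ l ∈ Finset.Ico i a, 0 ≤ padded M.weight l * f l := fun l hl =>
      hhigh l (Finset.mem_Ico.mp hl).1
    have hnonneg := Finset.sum_nonneg hIco
    refine ⟨by rw [cutSum_eq, hsplit]; linarith, fun hle => Or.inr (Or.inr ?_)⟩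
    rw [cutSum_eq, hsplit] at hle
    refine ⟨?_, ?_⟩
    · by_contra hne
      have hmem : i + 1 ∈ Finset.Ico i a := Finset.mem_Ico.mpr ⟨by omega, by omega⟩
      have hz := (Finset.sum_eq_zero_iff_of_nonneg hIco).mp (by linarith) _ hmem
      exact (mul_pos (hM.padded_weight_pos ⟨by omega, by omega⟩)
        (hgt (i + 1) (by omega) (by omega))).ne' hz
    · by_cases hm : a ≤ m
      · have := (mul_eq_zero.mp (le_antisymm (by linarith) hrf)).resolve_right (hgt a h hm).ne'
        linarith
      · rw [padded_of_not_mem _ (by omega)] at hra ⊢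
        exact le_antisymm hra hr

end BSCMix

/-! ### The inscribed polygon of a splitting. -/

theorem Fin.sum_ite_castSucc_lt_sub {n : ℕ} (c : Fin (n + 1) → ℝ) (j : Fin (n + 1)) :
    (∑ l : Fin n, if l.castSucc < j then c l.succ - c l.castSucc else 0) = c j - c 0 := by
  induction j using Fin.induction with
  | zero => simp
  | succ j ih =>
    have : ∀ l : Fin n, (if l.castSucc < j.succ then c l.succ - c l.castSucc else 0) =
        (if l.castSucc < j.castSucc then c l.succ - c l.castSucc else 0) +
          if l = j then c j.succ - c j.castSucc else 0 := by
      intro l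
      rcases lt_trichotomy l j with h | rfl | h
      · rw [if_pos (Fin.castSucc_lt_succ_iff.mpr h.le), if_pos (Fin.castSucc_lt_castSucc_iff.mpr h),
          if_neg h.ne, add_zero]
      · simp
      · rw [if_neg (fun h' => (Fin.castSucc_lt_succ_iff.mp h').not_gt h),
          if_neg (fun h' => (Fin.castSucc_lt_castSucc_iff.mp h').not_gt h), if_neg h.ne', add_zero]
    simp only [this, Finset.sum_add_distrib, ih, Finset.sum_ite_eq', Finset.mem_univ, if_true]
    ring

namespace Splitting

variable {m n : ℕ} {M : BSCMix m}

/-- The sum of `q_i f_i` below the `j`-th splitting pattern. -/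
def cut (P : Splitting M n) (f : ℕ → ℝ) (j : Fin (n + 1)) : ℝ :=
  M.cutSum f (P.idx j) (P.amt j)

/-- The total weight below the `j`-th splitting pattern. -/
abbrev pos (P : Splitting M n) (j : Fin (n + 1)) : ℝ := P.cut (fun _ => 1) j

theorem idx_le (P : Splitting M n) (j : Fin (n + 1)) : P.idx j ≤ m + 1 :=
  P.idx_last ▸ P.idx_strictMono.monotone (Fin.le_last j)

theorem idx_mem (P : Splitting M n) {j : Fin (n + 1)} (h0 : j ≠ 0) (hl : j ≠ Fin.last n) :
    1 ≤ P.idx j ∧ P.idx j ≤ m := by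
  have h1 := P.idx_strictMono (Fin.pos_iff_ne_zero.mpr h0)
  have h2 := P.idx_strictMono (Fin.lt_last_iff_ne_last.mpr hl)
  rw [P.idx_first] at h1
  rw [P.idx_last] at h2
  omega

theorem cut_zero (P : Splitting M n) (f : ℕ → ℝ) : P.cut f 0 = 0 := by
  rw [cut, P.idx_first, P.amt_first, BSCMix.cutSum, zero_add, Finset.sum_range_one,
    padded_of_not_mem _ (by omega)]
  ring

theorem cut_last (P : Splitting M n) (f : ℕ → ℝ) :
    P.cut f (Fin.last n) = M.cutSum f (m + 1) 0 := by
  rw [cut, P.idx_last, P.amt_last]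

theorem sum_segWeight_mul (P : Splitting M n) (f : ℕ → ℝ) (j : Fin n) :
    ∑ k ∈ Finset.range (m + 2), P.segWeight j k * f k =
      P.cut f j.succ - P.cut f j.castSucc := by
  have hlt : P.idx j.castSucc < P.idx j.succ := P.idx_strictMono Fin.castSucc_lt_succ
  have hle := P.idx_le j.succ
  have hk : ∀ k, P.segWeight j k * f k =
      ((if k < P.idx j.succ + 1 then padded M.weight k * f k else 0) -
        (if k < P.idx j.castSucc + 1 then padded M.weight k * f k else 0)) +
      ((if k = P.idx j.castSucc then P.amt j.castSucc * f k else 0) -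
        (if k = P.idx j.succ then P.amt j.succ * f k else 0)) := by
    intro k
    unfold segWeight
    split_ifs <;> first | omega | ring
  have hs : ∀ a, a ≤ m + 1 → (∑ k ∈ Finset.range (m + 2),
      if k < a + 1 then padded M.weight k * f k else 0) =
      ∑ k ∈ Finset.range (a + 1), padded M.weight k * f k := by
    intro a ha
    rw [← Finset.sum_filter]
    congr 1
    ext k
    simp only [Finset.mem_filter, Finset.mem_range]
    omega
  simp only [hk, Finset.sum_add_distrib, Finset.sum_sub_distrib, hs _ hle,
    hs _ (hlt.le.trans hle), Finset.sum_ite_eq', Finset.mem_range]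
  rw [if_pos (by omega), if_pos (by omega), cut, cut, BSCMix.cutSum, BSCMix.cutSum]
  ring

variable {P P' : Splitting M n} {D D' : BSCMix n}

theorem Compounds.weight_eq (h : P.Compounds D) (j : Fin n) :
    D.weight j = P.pos j.succ - P.pos j.castSucc := by
  rw [(h j).1, ← sum_segWeight_mul]
  simp

theorem Compounds.weight_mul_cross_eq (h : P.Compounds D) (j : Fin n) :
    D.weight j * D.cross j =
      P.cut (padded M.cross) j.succ - P.cut (padded M.cross) j.castSucc := by
  rw [(h j).2, sum_segWeight_mul]

theorem Compounds.sum_weight_lt (h : P.Compounds D) (j : Fin (n + 1)) :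
    (∑ l : Fin n, if l.castSucc < j then D.weight l else 0) = P.pos j := by
  simp only [h.weight_eq]
  rw [Fin.sum_ite_castSucc_lt_sub, pos, pos, P.cut_zero, sub_zero]

theorem Compounds.sum_weight_mul_cross_lt (h : P.Compounds D) (j : Fin (n + 1)) :
    (∑ l : Fin n, if l.castSucc < j then D.weight l * D.cross l else 0) =
      P.cut (padded M.cross) j := by
  simp only [h.weight_mul_cross_eq]
  rw [Fin.sum_ite_castSucc_lt_sub, P.cut_zero, sub_zero]

theorem Compounds.pos_strictMono (h : P.Compounds D) (hD : D.IsReduced) : StrictMono P.pos :=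
  Fin.strictMono_iff_lt_succ.mpr fun j => by
    have := hD.1 j
    rw [h.weight_eq] at this
    linarith

/-- For every `j` this bounds `∑ l, p_l * min ε_l t` from above, with equality when `j` separates
the `ε_l ≤ t` from the `ε_l ≥ t`. It translates truncated errors into supporting lines of slope `t`.
-/
theorem Compounds.sum_split (h : P.Compounds D) (j : Fin (n + 1)) (t : ℝ) :
    (∑ l : Fin n, D.weight l * if l.castSucc < j then D.cross l else t) =
      P.cut (padded M.cross) j + t * (1 - P.pos j) := by
  have : ∀ l : Fin n, (D.weight l * if l.castSucc < j then D.cross l else t) =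
      (if l.castSucc < j then D.weight l * D.cross l else 0) +
        (t * D.weight l - t * if l.castSucc < j then D.weight l else 0) := by
    intro l
    split_ifs <;> ring
  simp only [this, Finset.sum_add_distrib, Finset.sum_sub_distrib, ← Finset.mul_sum,
    D.weight_sum, h.sum_weight_lt, h.sum_weight_mul_cross_lt]
  ring

/-- The Lorenz curve of `D` lies above the supporting lines of the Lorenz curve of `D'`. -/
theorem Compounds.cut_sub_le_cut_sub (h : P.Compounds D) (h' : P'.Compounds D')
    (hD' : D'.IsReduced)
    (hmin : ∀ t, 0 ≤ t → ∑ l, D'.weight l * min (D'.cross l) t ≤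
      ∑ l, D.weight l * min (D.cross l) t) (j : Fin (n + 1)) (k : Fin n) :
    P'.cut (padded M.cross) k.castSucc - D'.cross k * P'.pos k.castSucc ≤
      P.cut (padded M.cross) j - D'.cross k * P.pos j := by
  have h1 := hmin _ (D'.cross_nonneg k)
  have h2 : ∑ l, D.weight l * min (D.cross l) (D'.cross k) ≤
      P.cut (padded M.cross) j + D'.cross k * (1 - P.pos j) := by
    rw [← h.sum_split]
    refine Finset.sum_le_sum fun l _ => mul_le_mul_of_nonneg_left ?_ (D.weight_nonneg l)
    split_ifs
    exacts [min_le_left _ _, min_le_right _ _]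
  have h3 : ∑ l, D'.weight l * min (D'.cross l) (D'.cross k) =
      P'.cut (padded M.cross) k.castSucc + D'.cross k * (1 - P'.pos k.castSucc) := by
    rw [← h'.sum_split]
    refine Finset.sum_congr rfl fun l _ => ?_
    split_ifs with hl
    · rw [min_eq_left (hD'.2.1.monotone (Fin.castSucc_lt_castSucc_iff.mp hl).le)]
    · rw [min_eq_right (hD'.2.1.monotone
        (not_lt.mp fun hlt => hl (Fin.castSucc_lt_castSucc_iff.mpr hlt)))]
  linarith

theorem pos_eq (P : Splitting M n) (j : Fin (n + 1)) :
    P.pos j = ∑ i ∈ Finset.range (P.idx j + 1), padded M.weight i - P.amt j := by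
  simp [pos, cut, BSCMix.cutSum]

theorem pos_eq' (P : Splitting M n) (j : Fin (n + 1)) :
    P.pos j = ∑ i ∈ Finset.range (P.idx j), padded M.weight i +
      (padded M.weight (P.idx j) - P.amt j) := by
  simp [pos, cut, BSCMix.cutSum_eq]

theorem cut_sub_const (P : Splitting M n) (f : ℕ → ℝ) (c : ℝ) (j : Fin (n + 1)) :
    P.cut (fun i => f i - c) j = P.cut f j - c * P.pos j :=
  M.cutSum_sub_const f c _ _

/-! ### Comparison of the vertices of two inscribed polygons. -/

/-- A point of `P` strictly inside a segment of `P'` lies inside an atom which is this segment. -/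
theorem segment_eq_atom (hM : M.IsReduced) (h : P.Compounds D) (h' : P'.Compounds D')
    (hD' : D'.IsReduced) (hadj' : P'.AdjacencyConditions D')
    (hmin : ∀ t, 0 ≤ t → ∑ l, D'.weight l * min (D'.cross l) t ≤
      ∑ l, D.weight l * min (D.cross l) t) {j : Fin (n + 1)} (hj : 1 ≤ P.idx j ∧ P.idx j ≤ m)
    {k : Fin n} (hlt : P'.pos k.castSucc < P.pos j) (hgt : P.pos j < P'.pos k.succ) :
    P'.pos k.castSucc = ∑ i ∈ Finset.range (P.idx j), padded M.weight i ∧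
      P'.pos k.succ = ∑ i ∈ Finset.range (P.idx j + 1), padded M.weight i := by
  have hline := h.cut_sub_le_cut_sub h' hD' hmin j k
  have hseg := h'.weight_mul_cross_eq k
  rw [h'.weight_eq k] at hseg
  obtain ⟨hl, hl'⟩ := hM.cutSum_cross_sub_le hj (P'.idx_le k.castSucc) (P.amt j)
    (P'.amt_nonneg k.castSucc) (P'.amt_le k.castSucc)
  obtain ⟨hr, hr'⟩ := hM.cutSum_cross_sub_le hj (P'.idx_le k.succ) (P.amt j)
    (P'.amt_nonneg k.succ) (P'.amt_le k.succ)
  change P.cut _ j ≤ P'.cut _ _ at hl hr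
  change P'.cut _ _ ≤ P.cut _ j → _ at hl' hr'
  simp only [cut_sub_const] at hl hl' hr hr'
  -- The line through the segment passes on or below the vertex of `P`, while the line of slope
  -- `σ_i` through that vertex passes on or below both ends of the segment. As the vertex is
  -- strictly between the ends, the two lines agree.
  have hσ : D'.cross k = padded M.cross (P.idx j) := by
    apply le_antisymm
    · refine le_of_mul_le_mul_right ?_ (sub_pos.mpr hlt)
      linarith
    · refine le_of_mul_le_mul_right ?_ (sub_pos.mpr hgt)
      linarith
  rw [hσ] at hline hseg
  replace hl' := hl' (by linarith)
  replace hr' := hr' (by linarith)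
  have hidx : P'.idx k.castSucc < P'.idx k.succ := P'.idx_strictMono Fin.castSucc_lt_succ
  have hamt := P.amt_nonneg j
  have hamt' := P.amt_le j
  have hpj := P.pos_eq j
  have hpj' := P.pos_eq' j
  have hpl := P'.pos_eq k.castSucc
  have hpl' := P'.pos_eq' k.castSucc
  have hpr := P'.pos_eq k.succ
  have hpr' := P'.pos_eq' k.succ
  have hadj := hadj' k
  -- Each end lies on atom `i`, either with index `i`, or as the top of atom `i - 1` (amount `0`),
  -- or as the bottom of atom `i + 1` (full amount). In the mixed cases the indices are adjacent,
  -- and an adjacency condition moves the end with index `i` to the required end of the atom.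
  rcases hl' with hl' | ⟨hl', ha⟩ | ⟨hl', ha⟩
  · rcases hr' with hr' | ⟨hr', hb⟩ | ⟨hr', hb⟩
    · omega
    · omega
    · have := ((hadj (by omega)).2 hb).1
      rw [hr'] at hpr' hb
      rw [hl'] at hpl' this
      constructor <;> linarith
  · have hpl0 : P'.pos k.castSucc = ∑ i ∈ Finset.range (P.idx j), padded M.weight i := by
      rw [hpl, ha, hl', sub_zero]
    refine ⟨hpl0, ?_⟩
    rcases hr' with hr' | ⟨hr', hb⟩ | ⟨hr', hb⟩
    · have := ((hadj (by omega)).1 ha).1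
      rw [hpr, this, hr', sub_zero]
    · omega
    · rw [hpr', hb, hr']
      ring
  · exfalso
    rw [hpl', ha, hl'] at hlt
    linarith

/-- If a point of `P` lies below the upper end of its atom, its predecessor lies strictly below
the lower end. -/
theorem AdjacencyConditions.pos_castSucc_lt (hM : M.IsReduced) (hadj : P.AdjacencyConditions D)
    {j : Fin n} (him : P.idx j.succ ≤ m)
    (hlt : P.pos j.succ < ∑ l ∈ Finset.range (P.idx j.succ + 1), padded M.weight l) :
    P.pos j.castSucc < ∑ l ∈ Finset.range (P.idx j.succ), padded M.weight l := by
  have hidx : P.idx j.castSucc < P.idx j.succ := P.idx_strictMono Fin.castSucc_lt_succ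
  have hamt := P.amt_nonneg j.castSucc
  have hmono := BSCMix.sum_range_weight_mono (M := M) (Nat.succ_le_of_lt hidx)
  rw [P.pos_eq j.castSucc]
  by_contra! hge
  -- An atom strictly between the two indices would have positive weight and keep the predecessor
  -- below.
  have hsucc : P.idx j.succ = P.idx j.castSucc + 1 := by
    by_contra hne
    have := hM.sum_range_weight_lt (a := P.idx j.castSucc + 1) (b := P.idx j.succ)
      (by omega) (by omega) (by omega)
    linarith
  have := ((hadj j hsucc).1 (by linarith)).1
  rw [P.pos_eq j.succ, this, sub_zero] at hlt
  exact hlt.false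

/-- If a point of `P` lies above the lower end of its atom, its successor lies strictly above
the upper end. -/
theorem AdjacencyConditions.lt_pos_succ (hM : M.IsReduced) (hadj : P.AdjacencyConditions D)
    {j : Fin n}
    (hlt : ∑ l ∈ Finset.range (P.idx j.castSucc), padded M.weight l < P.pos j.castSucc) :
    ∑ l ∈ Finset.range (P.idx j.castSucc + 1), padded M.weight l < P.pos j.succ := by
  have hidx : P.idx j.castSucc < P.idx j.succ := P.idx_strictMono Fin.castSucc_lt_succ
  have hle := P.idx_le j.succ
  have hamt := P.amt_le j.succ
  have hmono := BSCMix.sum_range_weight_mono (M := M) (Nat.succ_le_of_lt hidx)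
  rw [P.pos_eq' j.succ]
  by_contra! hge
  have hsucc : P.idx j.succ = P.idx j.castSucc + 1 := by
    by_contra hne
    have := hM.sum_range_weight_lt (a := P.idx j.castSucc + 1) (b := P.idx j.succ)
      (by omega) (by omega) (by omega)
    linarith
  have := ((hadj j hsucc).2 (by linarith)).1
  rw [P.pos_eq' j.castSucc, this, sub_self, add_zero] at hlt
  exact hlt.false

theorem pos_zero (P : Splitting M n) : P.pos 0 = 0 := P.cut_zero _

/-- In the downward induction, a vertex of `P` to the right of its counterpart would be interior to
the segment of `P'` on its right. That segment is an atom, so the next vertex of `P` would overshoot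
its end, against the induction hypothesis. The upward induction is the mirror image. -/
theorem pos_eq_of_sum_min_le (hM : M.IsReduced) (h : P.Compounds D) (hD : D.IsReduced)
    (hadj : P.AdjacencyConditions D) (h' : P'.Compounds D') (hD' : D'.IsReduced)
    (hadj' : P'.AdjacencyConditions D')
    (hmin : ∀ t, 0 ≤ t → ∑ l, D'.weight l * min (D'.cross l) t ≤
      ∑ l, D.weight l * min (D.cross l) t) (j : Fin (n + 1)) : P.pos j = P'.pos j := by
  have hmono := h.pos_strictMono hD
  have hlast : P.pos (Fin.last n) = P'.pos (Fin.last n) := by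
    rw [pos, pos, cut_last, cut_last]
  have hmem : ∀ (j : Fin (n + 1)) (k : Fin n), P'.pos k.castSucc < P.pos j →
      P.pos j < P'.pos k.succ → 1 ≤ P.idx j ∧ P.idx j ≤ m := by
    intro j k hlt hgt
    have hmono' := (h'.pos_strictMono hD').monotone
    refine P.idx_mem ?_ ?_
    · rintro rfl
      have := hmono' (Fin.zero_le k.castSucc)
      rw [pos_zero] at this hlt
      linarith
    · rintro rfl
      have := hmono' (Fin.le_last k.succ)
      linarith
  apply le_antisymm
  · induction j using Fin.reverseInduction with
    | last => exact hlast.le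
    | cast j ih =>
      by_contra! hlt
      have hgt : P.pos j.castSucc < P'.pos j.succ := (hmono Fin.castSucc_lt_succ).trans_le ih
      obtain ⟨h1, h2⟩ := segment_eq_atom hM h h' hD' hadj' hmin (hmem _ _ hlt hgt) hlt hgt
      rw [h1] at hlt
      have := hadj.lt_pos_succ hM hlt
      linarith
  · induction j using Fin.induction with
    | zero => rw [pos_zero, pos_zero]
    | succ j ih =>
      by_contra! hgt
      have hlt : P'.pos j.castSucc < P.pos j.succ := ih.trans_lt (hmono Fin.castSucc_lt_succ)
      have hi := hmem _ _ hlt hgt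
      obtain ⟨h1, h2⟩ := segment_eq_atom hM h h' hD' hadj' hmin hi hlt hgt
      rw [h2] at hgt
      have := hadj.pos_castSucc_lt hM hi.2 hgt
      linarith

/-- Both points lie on the Lorenz curve of `Q`, although equal abscissas do not force equal
patterns: an end shared by two atoms has two descriptions. The supporting line at the point of `P`
avoids this ambiguity. -/
theorem cut_cross_le_of_pos_eq (hM : M.IsReduced) {j : Fin (n + 1)} (hj : P.pos j = P'.pos j) :
    P.cut (padded M.cross) j ≤ P'.cut (padded M.cross) j := by
  by_cases h0 : j = 0
  · rw [h0, cut_zero, cut_zero]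
  by_cases hl : j = Fin.last n
  · rw [hl, cut_last, cut_last]
  have := (hM.cutSum_cross_sub_le (P.idx_mem h0 hl) (P'.idx_le j) (P.amt j) (P'.amt_nonneg j)
    (P'.amt_le j)).1
  change P.cut _ j ≤ P'.cut _ j at this
  rw [cut_sub_const, cut_sub_const, hj] at this
  linarith

/-- Two expressions that satisfy the adjacency conditions are equal if the first one is dominated
by the second one in the order of degradation. -/
theorem eq_of_sum_min_le (hM : M.IsReduced) (h : P.Compounds D) (hD : D.IsReduced)
    (hadj : P.AdjacencyConditions D) (h' : P'.Compounds D') (hD' : D'.IsReduced)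
    (hadj' : P'.AdjacencyConditions D')
    (hmin : ∀ t, 0 ≤ t → ∑ l, D'.weight l * min (D'.cross l) t ≤
      ∑ l, D.weight l * min (D.cross l) t) : D = D' := by
  have hpos := pos_eq_of_sum_min_le hM h hD hadj h' hD' hadj' hmin
  have hcut : ∀ j, P.cut (padded M.cross) j = P'.cut (padded M.cross) j := fun j =>
    le_antisymm (cut_cross_le_of_pos_eq hM (hpos j)) (cut_cross_le_of_pos_eq hM (hpos j).symm)
  have hw : ∀ j, D.weight j = D'.weight j := fun j => by
    rw [h.weight_eq, h'.weight_eq, hpos, hpos]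
  have hc : ∀ j, D.cross j = D'.cross j := fun j => by
    have := h.weight_mul_cross_eq j
    rw [hcut, hcut, ← h'.weight_mul_cross_eq, hw] at this
    exact mul_left_cancel₀ (hD'.1 j).ne' this
  cases D
  cases D'
  simp only [BSCMix.mk.injEq]
  exact ⟨funext hw, funext hc⟩

end Splitting

/-! ### From degradation of channels to the order of Lorenz curves. -/

theorem theorem4 {m n : ℕ} (hn : 2 ≤ n) (hnm : n < m) {A Y Y' : Type*}
    (Q : BIDMC A) (M : BSCMix m) (hM : M.IsReduced) (hQ : Q.Equivalent M.channel)
    (P P' : Splitting M n) (W : BIDMC Y) (W' : BIDMC Y')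
    (hW : W.IsPStarDegradation Q P) (hW' : W'.IsPStarDegradation Q P')
    (hadj : (P.patterns \ P'.patterns).ncard ≤ 2)
    (hle : W.IsDegradationOf W') : W.Equivalent W' := by
  obtain ⟨-, D, hD, hP, hPadj, hWD⟩ := hW
  obtain ⟨-, D', hD', hP', hPadj', hWD'⟩ := hW'
  have hmin : ∀ t, 0 ≤ t → ∑ l, D'.weight l * min (D'.cross l) t ≤
      ∑ l, D.weight l * min (D.cross l) t := by
    intro t ht
    have h := hle.truncatedError_le (ENNReal.ofReal t)
    rw [hWD.truncatedError_eq, hWD'.truncatedError_eq, D.truncatedError_channel hD.2.2 ht,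
      D'.truncatedError_channel hD'.2.2 ht, ENNReal.ofReal_le_ofReal_iff] at h
    · linarith
    · exact mul_nonneg zero_le_two (Finset.sum_nonneg fun l _ =>
        mul_nonneg (D.weight_nonneg l) (le_min (D.cross_nonneg l) ht))
  obtain rfl := Splitting.eq_of_sum_min_le hM hP hD hPadj hP' hD' hPadj' hmin
  exact fun ε hε => (hWD ε hε).trans (hWD' ε hε).symm
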